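/- **Theorem (cycle counting at node level).** Let $G$ be a simple undirected graph with node set $\{1,\dots,n\}$ and adjacency matrix $A\in\{0,1\}^{n\times n}$. Let $I$ be the identity matrix, $J$ the $n\times n$ matrix with zeros on the diagonal and ones elsewhere, $\mathbf 1$ the column vector of ones, $\odot$ the element-wise product, $\mathrm{diag}(v)$ the diagonal matrix with diagonal $v$, and $(M>0)$ the matrix whose $(i,j)$ entry is $1$ if $M_{i,j}>0$ and $0$ otherwise. The operation $\odot$ binds more tightly than the matrix product. Put $$ \begin{aligned} X_2 &= A^2\odot J,\\ X_3 &= A^3\odot J - A(A^2\odot I) - (A^2\odot I)A + A,\\ X_4 &= A^4\odot J - \big(A(A^2\odot I-2I)A\big)\odot J - (A^2\odot I)X_2 - X_2(A^2\odot I)\\ &\quad - A(A^3\odot I) - (A^3\odot I)A + 3A^2\odot A,\\ X_5 &= A^5\odot J - A(A^2\odot I)(A^2\odot I-I) - (A^2\odot I)A(A^2\odot I) - (A^2\odot I-I)(A^2\odot I)A\\ &\quad - \big(A(A^2\odot I-I)X_2\big)\odot J - \big(X_2(A^2\odot I-I)A\big)\odot J\\ &\quad - (A^2\odot I)X_3 -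 X_3(A^2\odot I-I) - (A^3\odot I)X_2 - X_2(A^3\odot I)\\ &\quad - \big(A(A^3\odot I)A\big)\odot J - A\odot A^2 + 3\big(A(A\odot A^2)+(A\odot A^2)A\big)\odot J\\ &\quad - A\,\mathrm{diag}\big((A\odot X_3)\mathbf 1\big) - \mathrm{diag}\big((A\odot X_3)\mathbf 1\big)A\\ &\quad + 3A\odot X_3 + 3A\odot A^2\odot\big(A^2-(A^2>0)\big), \end{aligned} $$ and $C_l = A\odot X_{l-1}$ for $3\le l\le 6$. Then for every $3\le l\le 6$ the vector $\tfrac12 C_l\mathbf 1$ is a vectorial word of the matrix language MATLANG: it is the value at $A$ of one expression, independent of $n$ and $G$, that is built from the matrix variable $A$ by matrix product, transpose, the vector of ones, $\mathrm{diag}$, the element-wise product, addition, multiplication by real constants and element-wise application of functions $\mathbb R\to\mathbb R$. Moreover, for every $n$, every such $G$ and every node $i$, the entry $\big(\tfrac12 C_l\mathbf 1\big)_i$ equals the number of $l$-cycles on which $i$ lies, that is, the number of subgraphs of $G$ that are isomorphic to the cycle with $l$ nodes and contain $i$. -/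

import Mathlib

open scoped Matrix

noncomputable section

namespace CycleCounting

/-! ### The matrix language MATLANG

The operations are those of `{·, ᵀ, 𝟙, diag, ⊙}` together with addition, multiplication by a
constant and pointwise application of a function. -/

/-- The two possible side lengths of a matrix described by a word: the number of nodes, or one. -/
inductive Side
  | node
  | one

/-- The side length in a graph with `n` nodes. -/
abbrev Side.size (n : ℕ) : Side → ℕ
  | .node => n
  | .one => 1

/-- Words of the language in one square matrix variable. `Word .node .one` are the vectorial words,
`Word .node .node` the words that describe square matrices, `Word .one .one` the sentences. -/
inductive Word : Side → Side → Type
  /-- the matrix variable -/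
  | var : Word .node .node
  /-- matrix product -/
  | mul {a b c : Side} : Word a b → Word b c → Word a c
  /-- transpose -/
  | transpose {a b : Side} : Word a b → Word b a
  /-- the column vector of ones with as many rows as the argument -/
  | ones {a b : Side} : Word a b → Word a .one
  /-- the diagonal matrix of a column vector -/
  | diag {a : Side} : Word a .one → Word a a
  /-- element-wise product -/
  | hadamard {a b : Side} : Word a b → Word a b → Word a b
  /-- matrix addition -/
  | add {a b : Side} : Word a b → Word a b → Word a b
  /-- multiplication by a constant -/
  | smul {a b : Side} : ℝ → Word a b → Word a b
  /-- element-wise application of a function -/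
  | app {a b : Side} : (ℝ → ℝ) → Word a b → Word a b

/-- The value of a word at a square matrix `A`. -/
def Word.eval {n : ℕ} (A : Matrix (Fin n) (Fin n) ℝ) :
    {a b : Side} → Word a b → Matrix (Fin (a.size n)) (Fin (b.size n)) ℝ
  | _, _, .var => A
  | _, _, .mul u v => u.eval A * v.eval A
  | _, _, .transpose u => (u.eval A)ᵀ
  | _, _, .ones _ => Matrix.of fun _ _ => 1
  | _, _, .diag u => Matrix.diagonal fun i => u.eval A i 0
  | _, _, .hadamard u v => Matrix.hadamard (u.eval A) (v.eval A)
  | _, _, .add u v => u.eval A + v.eval A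
  | _, _, .smul c u => c • u.eval A
  | _, _, .app f u => (u.eval A).map f

/-! ### The path matrices `X₂, …, X₅` and the cycle matrices `C₃, …, C₆` -/

section Matrices

variable {V : Type*} [Fintype V] [DecidableEq V]

/-- The matrix `J`: ones off the diagonal, zeros on it. -/
def offDiag (V : Type*) [DecidableEq V] : Matrix V V ℝ :=
  Matrix.of fun i j => if i = j then 0 else 1

/-- The matrix `(M > 0)`: the element-wise indicator of positivity. -/
def isPos (M : Matrix V V ℝ) : Matrix V V ℝ :=
  M.map fun x => if 0 < x then 1 else 0

/-- `X₂ = A² ⊙ J`. -/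
def pathX2 (A : Matrix V V ℝ) : Matrix V V ℝ :=
  (A ^ 2) ⊙ (offDiag V)

/-- `X₃ = A³ ⊙ J - A(A² ⊙ I) - (A² ⊙ I)A + A`. -/
def pathX3 (A : Matrix V V ℝ) : Matrix V V ℝ :=
  (A ^ 3) ⊙ (offDiag V) - A * ((A ^ 2) ⊙ 1) - ((A ^ 2) ⊙ 1) * A + A

/-- The matrix `X₄`. -/
def pathX4 (A : Matrix V V ℝ) : Matrix V V ℝ :=
  (A ^ 4) ⊙ (offDiag V) - (A * ((A ^ 2) ⊙ 1 - (2 : ℝ) • 1) * A) ⊙ (offDiag V)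
    - ((A ^ 2) ⊙ 1) * pathX2 A - pathX2 A * ((A ^ 2) ⊙ 1)
    - A * ((A ^ 3) ⊙ 1) - ((A ^ 3) ⊙ 1) * A + (3 : ℝ) • ((A ^ 2) ⊙ A)

/-- The matrix `X₅`. -/
def pathX5 (A : Matrix V V ℝ) : Matrix V V ℝ :=
  (A ^ 5) ⊙ (offDiag V) - A * ((A ^ 2) ⊙ 1) * ((A ^ 2) ⊙ 1 - 1)
    - ((A ^ 2) ⊙ 1) * A * ((A ^ 2) ⊙ 1) - ((A ^ 2) ⊙ 1 - 1) * ((A ^ 2) ⊙ 1) * A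
    - (A * ((A ^ 2) ⊙ 1 - 1) * pathX2 A) ⊙ (offDiag V)
    - (pathX2 A * ((A ^ 2) ⊙ 1 - 1) * A) ⊙ (offDiag V)
    - ((A ^ 2) ⊙ 1) * pathX3 A - pathX3 A * ((A ^ 2) ⊙ 1 - 1)
    - ((A ^ 3) ⊙ 1) * pathX2 A - pathX2 A * ((A ^ 3) ⊙ 1)
    - (A * ((A ^ 3) ⊙ 1) * A) ⊙ (offDiag V) - A ⊙ (A ^ 2)
    + (3 : ℝ) • ((A * (A ⊙ (A ^ 2)) + (A ⊙ (A ^ 2)) * A) ⊙ (offDiag V))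
    - A * Matrix.diagonal ((A ⊙ (pathX3 A)) *ᵥ 1) - Matrix.diagonal ((A ⊙ (pathX3 A)) *ᵥ 1) * A
    + (3 : ℝ) • (A ⊙ (pathX3 A)) + (3 : ℝ) • (A ⊙ (A ^ 2) ⊙ (A ^ 2 - isPos (A ^ 2)))

/-- The matrix `X_l` for `2 ≤ l ≤ 5` (the value for other `l` is irrelevant). -/
def pathX (l : ℕ) (A : Matrix V V ℝ) : Matrix V V ℝ :=
  match l with
  | 2 => pathX2 A
  | 3 => pathX3 A
  | 4 => pathX4 A
  | 5 => pathX5 A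
  | _ => 0

/-- The matrix `C_l = A ⊙ X_{l-1}` for `3 ≤ l ≤ 6`. -/
def cycleC (l : ℕ) (A : Matrix V V ℝ) : Matrix V V ℝ :=
  A ⊙ (pathX (l - 1) A)

end Matrices

/-! ### Counting cycles -/

/-- The number of `l`-cycles of `G` that the node `i` lies on: the number of subgraphs of `G`
that are isomorphic to the cycle graph on `l` nodes and have `i` among their nodes. -/
def nodeCycleCount {V : Type*} (G : SimpleGraph V) (l : ℕ) (i : V) : ℕ :=
  {H : G.Subgraph | i ∈ H.verts ∧ Nonempty (H.coe ≃g SimpleGraph.cycleGraph l)}.ncard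

end CycleCounting

end

namespace CycleCounting

/-! ### Rooted copies of a cycle -/

section RootedCopies

open SimpleGraph

/-! A cycle through `i` can be traversed from `i` in exactly two directions, because the only
automorphisms of a cycle that fix a node are the identity and the reflection. Hence twice the number
of `l`-cycles at `i` is the number of injective node sequences that start at `i` and close up
(`card_isRootedCycle`). Grouped by the last node `j`, this is the sum over the neighbours `j` of `i`
of the number of paths with `l - 1` edges from `i` to `j`. Since `C_l = A ⊙ X_{l-1}`, it is enough
that `X_{l-1}` counts paths between adjacent nodes, and `A i j = 1` simplifies every correction
term.

The paths are counted by inclusion-exclusion on walks. For length four the middle node `b` is fixed,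
for length five the middle edge `b`, `c`. The two remaining nodes, next to `i` and `j`, then range
independently except that they must differ, so their count is a product minus a diagonal sum
(`middleCount`, `edgeCount`). Summing over the middle gives entries of powers of `A`; the middle
positions equal to `i` or `j` are then removed. The results (`sum_path_three`, `sum_path_four`,
`sum_path_five`) agree with the expanded entries of the matrices (`pathX3_apply`, `pathX4_apply`,
`pathX5_apply`).

Expressibility is a closure argument: `Expressible` is stable under every operation used in the
formulas. -/

theorem cycleGraph_adj_neg {m : ℕ} {u v : Fin (m + 3)}
    (h : (cycleGraph (m + 3)).Adj u v) : (cycleGraph (m + 3)).Adj (-u) (-v) := by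
  rw [cycleGraph_adj (n := m + 1)] at h ⊢
  rcases h with h | h
  · right; rw [← h]; abel
  · left; rw [← h]; abel

/-- Modulo a number at least three, `1 + 1` is not zero. This makes the two directions of traversal
different. -/
theorem fin_one_ne_neg_one (m : ℕ) : (1 : Fin (m + 3)) ≠ -1 := by
  intro h
  have h2 : (1 : Fin (m + 3)) + 1 = 0 := by
    nth_rewrite 2 [h]; exact add_neg_cancel _
  have := congrArg Fin.val h2
  simp only [Fin.val_add, Fin.val_one, Fin.val_zero] at this
  rw [Nat.mod_eq_of_lt (by omega)] at this
  omega

/-- An injective endomorphism of a cycle that fixes two consecutive nodes is the identity. -/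
theorem eq_id_of_fix {m : ℕ} (σ : Fin (m + 3) → Fin (m + 3)) (hσ : Function.Injective σ)
    (hadj : ∀ u v, (cycleGraph (m + 3)).Adj u v → (cycleGraph (m + 3)).Adj (σ u) (σ v))
    (h0 : σ 0 = 0) (h1 : σ 1 = 1) : σ = id := by
  -- The induction carries two consecutive fixed nodes: the image of the next node is a neighbour of
  -- the second one, and injectivity rules out the first.
  have key : ∀ k : ℕ, σ (Fin.ofNat (m + 3) k) = Fin.ofNat (m + 3) k ∧
      σ (Fin.ofNat (m + 3) k + 1) = Fin.ofNat (m + 3) k + 1 := by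
    intro k
    induction k with
    | zero => exact ⟨h0, by simpa using h1⟩
    | succ k ih =>
      have e : (Fin.ofNat (m + 3) (k + 1)) = Fin.ofNat (m + 3) k + 1 := by
        ext; simp [Fin.val_add]
      rw [e]
      set x := Fin.ofNat (m + 3) k
      refine ⟨ih.2, ?_⟩
      have ha : (cycleGraph (m + 3)).Adj (x + 1) (x + 1 + 1) := by
        rw [cycleGraph_adj (n := m + 1)]; right; abel
      have := hadj _ _ ha
      rw [ih.2, cycleGraph_adj (n := m + 1)] at this
      rcases this with h | h
      · exfalso
        have h' : σ (x + 1 + 1) = x := by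
          rw [sub_eq_iff_eq_add, add_comm (1 : Fin (m + 3))] at h
          exact (add_right_cancel h).symm
        rw [← ih.1] at h'
        have h2 := hσ h'
        rw [ih.1] at h2
        have h3 : (1 : Fin (m + 3)) + 1 = 0 := by
          rwa [add_assoc, add_eq_left] at h2
        exact fin_one_ne_neg_one m (eq_neg_of_add_eq_zero_left h3)
      · rw [sub_eq_iff_eq_add] at h
        exact h.trans (add_comm 1 (x + 1))
  funext x
  have := (key x.val).1
  simpa using this

/-- An injective endomorphism of a cycle that fixes a node is the identity or the reflection. -/
theorem eq_id_or_neg {m : ℕ} (σ : Fin (m + 3) → Fin (m + 3)) (hσ : Function.Injective σ)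
    (hadj : ∀ u v, (cycleGraph (m + 3)).Adj u v → (cycleGraph (m + 3)).Adj (σ u) (σ v))
    (h0 : σ 0 = 0) : σ = id ∨ σ = Neg.neg := by
  have ha : (cycleGraph (m + 3)).Adj 0 1 := by
    rw [cycleGraph_adj (n := m + 1)]; right; simp
  have := hadj _ _ ha
  rw [h0, cycleGraph_adj (n := m + 1)] at this
  rcases this with h | h
  · right
    -- Here `σ` sends `1` to `-1`, so `σ` followed by the reflection fixes both `0` and `1`.
    have := eq_id_of_fix (fun k => -σ k) (fun a b hab => hσ (neg_injective hab))
      (fun u v huv => cycleGraph_adj_neg (hadj u v huv)) (by simp [h0]) (by simpa using h)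
    funext k
    rw [← neg_neg (σ k)]
    exact congrArg Neg.neg (congrFun this k)
  · left
    exact eq_id_of_fix σ hσ hadj h0 (by simpa using h)

variable {V : Type*} {G : SimpleGraph V} {m : ℕ}

/-- A copy of a cycle, traversed backwards from the same node. -/
def reverseCopy (f : Copy (cycleGraph (m + 3)) G) : Copy (cycleGraph (m + 3)) G where
  toHom := ⟨fun k => f (-k), fun h => f.toHom.map_adj (cycleGraph_adj_neg h)⟩
  injective' := fun _ _ h => neg_injective (f.injective h)

theorem reverseCopy_apply (f : Copy (cycleGraph (m + 3)) G) (k : Fin (m + 3)) :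
    reverseCopy f k = f (-k) := rfl

theorem toSubgraph_adj (f : Copy (cycleGraph (m + 3)) G) (x y : V) :
    f.toSubgraph.Adj x y ↔ ∃ u v, (cycleGraph (m + 3)).Adj u v ∧ f u = x ∧ f v = y := by
  simp [Copy.toSubgraph, Relation.Map]

theorem mem_verts_toSubgraph (f : Copy (cycleGraph (m + 3)) G) (x : V) :
    x ∈ f.toSubgraph.verts ↔ ∃ u, f u = x := by
  simp [Copy.toSubgraph]

theorem toSubgraph_reverseCopy (f : Copy (cycleGraph (m + 3)) G) :
    (reverseCopy f).toSubgraph = f.toSubgraph := by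
  ext x y
  · rw [mem_verts_toSubgraph, mem_verts_toSubgraph]
    constructor
    · rintro ⟨u, hu⟩; exact ⟨-u, hu⟩
    · rintro ⟨u, hu⟩; exact ⟨-u, by rw [reverseCopy_apply, neg_neg, hu]⟩
  · rw [toSubgraph_adj, toSubgraph_adj]
    constructor
    · rintro ⟨u, v, h, hu, hv⟩; exact ⟨-u, -v, cycleGraph_adj_neg h, hu, hv⟩
    · rintro ⟨u, v, h, hu, hv⟩
      refine ⟨-u, -v, cycleGraph_adj_neg h, ?_, ?_⟩ <;> rwa [reverseCopy_apply, neg_neg]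

theorem reverseCopy_ne (f : Copy (cycleGraph (m + 3)) G) : reverseCopy f ≠ f := by
  intro h
  have := DFunLike.congr_fun h 1
  rw [reverseCopy_apply] at this
  exact fin_one_ne_neg_one m (f.injective this).symm

/-- Equal images let `g` factor as `f ∘ σ`, where `σ` is an injective endomorphism of the cycle
fixing `0`; then `eq_id_or_neg` applies. -/
theorem eq_or_eq_reverseCopy (f g : Copy (cycleGraph (m + 3)) G) (h0 : g 0 = f 0)
    (h : g.toSubgraph = f.toSubgraph) : g = f ∨ g = reverseCopy f := by
  have hv : ∀ k, ∃ u, f u = g k := by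
    intro k
    rw [← mem_verts_toSubgraph, ← h, mem_verts_toSubgraph]
    exact ⟨k, rfl⟩
  choose σ hσ using hv
  have hinj : Function.Injective σ := fun a b hab => g.injective (by
    rw [Copy.coe_toHom, ← hσ, ← hσ, hab])
  have hadj : ∀ u v, (cycleGraph (m + 3)).Adj u v → (cycleGraph (m + 3)).Adj (σ u) (σ v) := by
    intro u v huv
    have := (toSubgraph_adj g (g u) (g v)).2 ⟨u, v, huv, rfl, rfl⟩
    rw [h, toSubgraph_adj] at this
    obtain ⟨a, b, hab, ha, hb⟩ := this
    rw [← hσ] at ha hb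
    rwa [← f.injective ha, ← f.injective hb]
  rcases eq_id_or_neg σ hinj hadj (f.injective ((hσ 0).trans h0)) with rfl | rfl
  · left; ext k; exact (hσ k).symm
  · right; ext k; exact (hσ k).symm

theorem exists_rooted_copy (H : G.Subgraph) (i : V) (hi : i ∈ H.verts)
    (e : cycleGraph (m + 3) ≃g H.coe) :
    ∃ f : Copy (cycleGraph (m + 3)) G, f 0 = i ∧ f.toSubgraph = H := by
  have : H ∈ Set.range (Copy.toSubgraph (A := cycleGraph (m + 3)) (B := G)) := by
    rw [Copy.range_toSubgraph]; exact ⟨e⟩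
  obtain ⟨f, rfl⟩ := this
  obtain ⟨k, hk⟩ := (mem_verts_toSubgraph f i).1 hi
  -- Rotating by the position `k` of `i` moves the root to `0`; adjacency in the cycle depends only
  -- on differences.
  refine ⟨⟨⟨fun x => f (x + k), fun {a b} h => f.toHom.map_adj ?_⟩, fun a b h =>
    add_right_cancel (f.injective h)⟩, ?_, ?_⟩
  · rw [cycleGraph_adj (n := m + 1)] at h ⊢
    simpa using h
  · change f (0 + k) = i
    rw [zero_add, hk]
  · ext x y
    · rw [mem_verts_toSubgraph, mem_verts_toSubgraph]
      constructor
      · rintro ⟨u, hu⟩; exact ⟨u + k, hu⟩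
      · rintro ⟨u, hu⟩
        refine ⟨u - k, ?_⟩
        change f (u - k + k) = x
        rw [sub_add_cancel, hu]
    · rw [toSubgraph_adj, toSubgraph_adj]
      constructor
      · rintro ⟨u, v, h, hu, hv⟩
        refine ⟨u + k, v + k, ?_, hu, hv⟩
        rw [cycleGraph_adj (n := m + 1)] at h ⊢
        simpa using h
      · rintro ⟨u, v, h, hu, hv⟩
        refine ⟨u - k, v - k, ?_, ?_, ?_⟩
        · rw [cycleGraph_adj (n := m + 1)] at h ⊢
          simpa using h
        · change f (u - k + k) = x
          rw [sub_add_cancel, hu]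
        · change f (v - k + k) = y
          rw [sub_add_cancel, hv]

/-- A node sequence is a cycle rooted at `i`: it starts at `i`, has no repetition, and any two
cyclically consecutive nodes are adjacent. -/
def IsRootedCycle (G : SimpleGraph V) (i : V) (f : Fin (m + 3) → V) : Prop :=
  f 0 = i ∧ Function.Injective f ∧ ∀ k, G.Adj (f k) (f (k + 1))

/-- Copies of a cycle rooted at `i` as node sequences. -/
def rootedCopyEquiv (G : SimpleGraph V) (i : V) (m : ℕ) :
    {f : Copy (cycleGraph (m + 3)) G // f 0 = i} ≃
      {f : Fin (m + 3) → V // IsRootedCycle G i f} where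
  toFun f := ⟨f.1, f.2, f.1.injective, fun k => f.1.toHom.map_adj (by
    rw [cycleGraph_adj (n := m + 1)]; right; abel)⟩
  invFun f := ⟨⟨⟨f.1, fun {a b} h => by
    rw [cycleGraph_adj (n := m + 1), sub_eq_iff_eq_add', sub_eq_iff_eq_add'] at h
    rcases h with rfl | rfl
    · exact (f.2.2.2 b).symm
    · exact f.2.2.2 a⟩, f.2.2.1⟩, f.2.1⟩
  left_inv _ := rfl
  right_inv _ := rfl

open Classical in
/-- Every cycle through a node is traversed by exactly two rooted cycles. -/
theorem card_isRootedCycle [Fintype V] (G : SimpleGraph V) (i : V) (m : ℕ) :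
    Fintype.card {f : Fin (m + 3) → V // IsRootedCycle G i f} =
      2 * nodeCycleCount G (m + 3) i := by
  rw [← Fintype.card_congr (rootedCopyEquiv G i m), Fintype.card_subtype,
    Finset.card_eq_sum_card_image Copy.toSubgraph, Finset.sum_const_nat (m := 2), mul_comm,
    nodeCycleCount, ← Set.ncard_coe_finset]
  · congr 2
    ext H
    simp only [Finset.coe_image, Finset.coe_filter, Finset.mem_univ, true_and, Set.mem_image,
      Set.mem_ofPred_eq]
    constructor
    · rintro ⟨f, h0, rfl⟩
      exact ⟨(mem_verts_toSubgraph f i).2 ⟨0, h0⟩, ⟨f.isoToSubgraph.symm⟩⟩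
    · rintro ⟨hi, ⟨e⟩⟩
      exact exists_rooted_copy H i hi e.symm
  -- Each nonempty fibre of `Copy.toSubgraph` over rooted copies consists of one copy and its
  -- reverse.
  · intro H hH
    obtain ⟨f, hf, rfl⟩ := Finset.mem_image.1 hH
    have h0 : f 0 = i := by simpa using hf
    rw [Finset.card_eq_two]
    refine ⟨f, reverseCopy f, (reverseCopy_ne f).symm, ?_⟩
    ext g
    simp only [Finset.mem_filter, Finset.mem_univ, true_and, Finset.mem_insert,
      Finset.mem_singleton]
    constructor
    · rintro ⟨hg, hs⟩
      exact eq_or_eq_reverseCopy f g (hg.trans h0.symm) hs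
    · rintro (rfl | rfl)
      · exact ⟨h0, rfl⟩
      · exact ⟨by rw [reverseCopy_apply, neg_zero, h0], toSubgraph_reverseCopy f⟩

end RootedCopies

theorem sum_fin_succ_fun {V : Type*} [Fintype V] {M : Type*} [AddCommMonoid M] {n : ℕ}
    (F : (Fin (n + 1) → V) → M) :
    ∑ f, F f = ∑ a, ∑ g : Fin n → V, F (Matrix.vecCons a g) := by
  rw [← (Fin.consEquiv fun _ => V).sum_comp, Fintype.sum_prod_type]
  rfl

/-! ### Matrix functions described by words -/

/-- A matrix function is expressible if one word describes it for all numbers of nodes. -/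
def Expressible {a b : Side}
    (F : ∀ n, Matrix (Fin n) (Fin n) ℝ → Matrix (Fin (a.size n)) (Fin (b.size n)) ℝ) : Prop :=
  ∃ w : Word a b, ∀ n (A : Matrix (Fin n) (Fin n) ℝ), w.eval A = F n A

namespace Expressible

variable {a b c : Side}
  {F H : ∀ n, Matrix (Fin n) (Fin n) ℝ → Matrix (Fin (a.size n)) (Fin (b.size n)) ℝ}
  {K : ∀ n, Matrix (Fin n) (Fin n) ℝ → Matrix (Fin (b.size n)) (Fin (c.size n)) ℝ}

theorem var : Expressible (a := .node) (b := .node) fun _ A => A := ⟨.var, fun _ _ => rfl⟩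

theorem mul (hF : Expressible F) (hK : Expressible K) :
    Expressible fun n A => F n A * K n A := by
  obtain ⟨u, hu⟩ := hF
  obtain ⟨v, hv⟩ := hK
  exact ⟨.mul u v, fun n A => by rw [Word.eval, hu, hv]⟩

theorem hadamard (hF : Expressible F) (hH : Expressible H) :
    Expressible fun n A => F n A ⊙ H n A := by
  obtain ⟨u, hu⟩ := hF
  obtain ⟨v, hv⟩ := hH
  exact ⟨.hadamard u v, fun n A => by rw [Word.eval, hu, hv]⟩

theorem add (hF : Expressible F) (hH : Expressible H) :
    Expressible fun n A => F n A + H n A := by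
  obtain ⟨u, hu⟩ := hF
  obtain ⟨v, hv⟩ := hH
  exact ⟨.add u v, fun n A => by rw [Word.eval, hu, hv]⟩

theorem smul (r : ℝ) (hF : Expressible F) : Expressible fun n A => r • F n A := by
  obtain ⟨u, hu⟩ := hF
  exact ⟨.smul r u, fun n A => by rw [Word.eval, hu]⟩

theorem sub (hF : Expressible F) (hH : Expressible H) :
    Expressible fun n A => F n A - H n A := by
  obtain ⟨w, hw⟩ := hF.add (hH.smul (-1))
  exact ⟨w, fun n A => by simp [hw, sub_eq_add_neg]⟩

theorem map (f : ℝ → ℝ) (hF : Expressible F) : Expressible fun n A => (F n A).map f := by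
  obtain ⟨u, hu⟩ := hF
  exact ⟨.app f u, fun n A => by rw [Word.eval, hu]⟩

theorem ones : Expressible (a := .node) (b := .one) fun _ _ => Matrix.of fun _ _ => 1 :=
  -- The argument `.var` only supplies the number of rows.
  ⟨.ones .var, fun _ _ => rfl⟩

theorem diagonal
    {F : ∀ n, Matrix (Fin n) (Fin n) ℝ → Matrix (Fin (a.size n)) (Fin (Side.one.size n)) ℝ}
    (hF : Expressible F) : Expressible fun n A => Matrix.diagonal fun i => F n A i 0 := by
  obtain ⟨u, hu⟩ := hF
  exact ⟨.diag u, fun n A => by rw [Word.eval, hu]⟩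

theorem one : Expressible (a := .node) (b := .node) fun _ _ => 1 := by
  obtain ⟨w, hw⟩ := ones.diagonal
  exact ⟨w, fun n A => by rw [hw]; rfl⟩

/-- `J` is not a primitive of the language; it is the identity with `x ↦ 1 - x` applied to each
entry. -/
theorem offDiag : Expressible (a := .node) (b := .node) fun n _ => offDiag (Fin n) := by
  obtain ⟨w, hw⟩ := one.map fun x => 1 - x
  refine ⟨w, fun n A => ?_⟩
  rw [hw]
  ext i j
  by_cases h : i = j <;> simp [CycleCounting.offDiag, h]

section Square

variable {F : ∀ n, Matrix (Fin n) (Fin n) ℝ → Matrix (Fin n) (Fin n) ℝ}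

theorem pow (hF : Expressible (a := .node) (b := .node) F) (k : ℕ) :
    Expressible (a := .node) (b := .node) fun n A => F n A ^ k := by
  induction k with
  | zero => simpa only [pow_zero] using one
  | succ k ih => simpa only [pow_succ] using ih.mul hF

theorem isPos (hF : Expressible (a := .node) (b := .node) F) :
    Expressible (a := .node) (b := .node) fun n A => isPos (F n A) :=
  hF.map _

theorem rowSum (hF : Expressible (a := .node) (b := .node) F) :
    Expressible (a := .node) (b := .one) fun n A => Matrix.of fun i _ => (F n A *ᵥ 1) i := by
  obtain ⟨w, hw⟩ := hF.mul ones
  refine ⟨w, fun n A => ?_⟩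
  rw [hw]
  ext i j
  simp [Matrix.mul_apply, Matrix.mulVec, dotProduct]

theorem diagonal_rowSum (hF : Expressible (a := .node) (b := .node) F) :
    Expressible (a := .node) (b := .node) fun n A => Matrix.diagonal (F n A *ᵥ 1) :=
  hF.rowSum.diagonal

end Square

theorem pathX2 : Expressible (a := .node) (b := .node) fun _ A => pathX2 A :=
  (var.pow 2).hadamard offDiag

theorem degree : Expressible (a := .node) (b := .node) fun _ A => (A ^ 2) ⊙ 1 :=
  (var.pow 2).hadamard one

theorem triangle : Expressible (a := .node) (b := .node) fun _ A => (A ^ 3) ⊙ 1 :=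
  (var.pow 3).hadamard one

theorem pathX3 : Expressible (a := .node) (b := .node) fun _ A => pathX3 A :=
  ((((var.pow 3).hadamard offDiag).sub (var.mul degree)).sub (degree.mul var)).add var

theorem pathX4 : Expressible (a := .node) (b := .node) fun _ A => pathX4 A :=
  (((((((var.pow 4).hadamard offDiag).sub
    (((var.mul (degree.sub (one.smul 2))).mul var).hadamard offDiag)).sub
    (degree.mul pathX2)).sub (pathX2.mul degree)).sub
    (var.mul triangle)).sub (triangle.mul var)).add (((var.pow 2).hadamard var).smul 3)

theorem pathX5 : Expressible (a := .node) (b := .node) fun _ A => pathX5 A := by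
  have h1 := degree.sub one
  have hs := (var.hadamard pathX3).diagonal_rowSum
  have ht := var.hadamard (var.pow 2)
  have hp := (ht.hadamard ((var.pow 2).sub (var.pow 2).isPos)).smul 3
  exact (((((((((((((((((var.pow 5).hadamard offDiag).sub ((var.mul degree).mul h1)).sub
    ((degree.mul var).mul degree)).sub ((h1.mul degree).mul var)).sub
    (((var.mul h1).mul pathX2).hadamard offDiag)).sub
    (((pathX2.mul h1).mul var).hadamard offDiag)).sub
    (degree.mul pathX3)).sub (pathX3.mul h1)).sub
    (triangle.mul pathX2)).sub (pathX2.mul triangle)).sub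
    (((var.mul triangle).mul var).hadamard offDiag)).sub ht).add
    ((((var.mul ht).add (ht.mul var)).hadamard offDiag).smul 3)).sub
    (var.mul hs)).sub (hs.mul var)).add
    ((var.hadamard pathX3).smul 3)).add hp

theorem pathX (l : ℕ) (hl : 2 ≤ l) (hl' : l ≤ 5) :
    Expressible (a := .node) (b := .node) fun _ A => pathX l A := by
  interval_cases l
  exacts [pathX2, pathX3, pathX4, pathX5]

theorem half_rowSum_cycleC (l : ℕ) (hl : 3 ≤ l) (hl' : l ≤ 6) :
    Expressible (a := .node) (b := .one) fun _ A =>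
      (1 / 2 : ℝ) • Matrix.of fun i _ => (cycleC l A *ᵥ 1) i :=
  (var.hadamard (pathX (l - 1) (by omega) (by omega))).rowSum.smul _

end Expressible

/-! ### Rooted cycles as sums of products of matrix entries -/

section IsRootedCycle

variable {V : Type*} {G : SimpleGraph V} {i x a b c d j : V}

/-- Here and for longer cycles, inequalities are listed only for positions that are not consecutive;
the others follow from adjacency. The closing edge is written from `x` to `j` so that it becomes the
factor `A i j`. -/
theorem isRootedCycle_three_iff : IsRootedCycle (m := 0) G i ![x, a, j] ↔
    x = i ∧ G.Adj x a ∧ G.Adj a j ∧ G.Adj x j := by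
  constructor
  · rintro ⟨h0, -, h⟩
    exact ⟨h0, h 0, h 1, (h 2).symm⟩
  · rintro ⟨h0, h1, h2, h3⟩
    refine ⟨h0, ?_, ?_⟩
    · have := h1.ne; have := h2.ne; have := h3.ne
      intro k l
      fin_cases k <;> fin_cases l <;> simp <;> tauto
    · intro k
      fin_cases k
      exacts [h1, h2, h3.symm]

theorem isRootedCycle_four_iff : IsRootedCycle (m := 1) G i ![x, a, b, j] ↔
    x = i ∧ G.Adj x a ∧ G.Adj a b ∧ G.Adj b j ∧ G.Adj x j ∧ x ≠ b ∧ a ≠ j := by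
  constructor
  · rintro ⟨h0, hi, h⟩
    exact ⟨h0, h 0, h 1, h 2, (h 3).symm, hi.ne (a₁ := 0) (a₂ := 2) (by decide),
      hi.ne (a₁ := 1) (a₂ := 3) (by decide)⟩
  · rintro ⟨h0, h1, h2, h3, h4, h5, h6⟩
    refine ⟨h0, ?_, ?_⟩
    · have := h1.ne; have := h2.ne; have := h3.ne; have := h4.ne
      intro k l
      fin_cases k <;> fin_cases l <;> simp <;> tauto
    · intro k
      fin_cases k
      exacts [h1, h2, h3, h4.symm]

theorem isRootedCycle_five_iff : IsRootedCycle (m := 2) G i ![x, a, b, c, j] ↔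
    x = i ∧ G.Adj x a ∧ G.Adj a b ∧ G.Adj b c ∧ G.Adj c j ∧ G.Adj x j ∧
      x ≠ b ∧ b ≠ j ∧ a ≠ j ∧ x ≠ c ∧ a ≠ c := by
  constructor
  · rintro ⟨h0, hi, h⟩
    exact ⟨h0, h 0, h 1, h 2, h 3, (h 4).symm, hi.ne (a₁ := 0) (a₂ := 2) (by decide),
      hi.ne (a₁ := 2) (a₂ := 4) (by decide), hi.ne (a₁ := 1) (a₂ := 4) (by decide),
      hi.ne (a₁ := 0) (a₂ := 3) (by decide), hi.ne (a₁ := 1) (a₂ := 3) (by decide)⟩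
  · rintro ⟨h0, h1, h2, h3, h4, h5, h6, h7, h8, h9, h10⟩
    refine ⟨h0, ?_, ?_⟩
    · have := h1.ne; have := h2.ne; have := h3.ne; have := h4.ne; have := h5.ne
      intro k l
      fin_cases k <;> fin_cases l <;> simp <;> tauto
    · intro k
      fin_cases k
      exacts [h1, h2, h3, h4, h5.symm]

theorem isRootedCycle_six_iff : IsRootedCycle (m := 3) G i ![x, a, b, c, d, j] ↔
    x = i ∧ G.Adj x a ∧ G.Adj a b ∧ G.Adj b c ∧ G.Adj c d ∧ G.Adj d j ∧ G.Adj x j ∧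
      x ≠ b ∧ b ≠ j ∧ x ≠ c ∧ c ≠ j ∧ a ≠ c ∧ a ≠ j ∧ x ≠ d ∧ b ≠ d ∧ a ≠ d := by
  constructor
  · rintro ⟨h0, hi, h⟩
    exact ⟨h0, h 0, h 1, h 2, h 3, h 4, (h 5).symm, hi.ne (a₁ := 0) (a₂ := 2) (by decide),
      hi.ne (a₁ := 2) (a₂ := 5) (by decide), hi.ne (a₁ := 0) (a₂ := 3) (by decide),
      hi.ne (a₁ := 3) (a₂ := 5) (by decide), hi.ne (a₁ := 1) (a₂ := 3) (by decide),
      hi.ne (a₁ := 1) (a₂ := 5) (by decide), hi.ne (a₁ := 0) (a₂ := 4) (by decide),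
      hi.ne (a₁ := 2) (a₂ := 4) (by decide), hi.ne (a₁ := 1) (a₂ := 4) (by decide)⟩
  · rintro ⟨h0, h1, h2, h3, h4, h5, h6, h7, h8, h9, h10, h11, h12, h13, h14, h15⟩
    refine ⟨h0, ?_, ?_⟩
    · have := h1.ne; have := h2.ne; have := h3.ne; have := h4.ne; have := h5.ne; have := h6.ne
      intro k l
      fin_cases k <;> fin_cases l <;> simp <;> tauto
    · intro k
      fin_cases k
      exacts [h1, h2, h3, h4, h5, h6.symm]

end IsRootedCycle

theorem ite_and_eq_mul (p q : Prop) [Decidable p] [Decidable q] :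
    (if p ∧ q then (1 : ℝ) else 0) = (if p then 1 else 0) * (if q then 1 else 0) := by
  by_cases p <;> by_cases q <;> simp [*]

variable {V : Type*}

theorem ite_adj_eq (G : SimpleGraph V) [DecidableRel G.Adj] (x y : V) :
    (if G.Adj x y then (1 : ℝ) else 0) = G.adjMatrix ℝ x y := rfl

/-! ### Reordering sums over node tuples -/

section Sums

variable [Fintype V]

theorem sum_fin_zero_fun (F : (Fin 0 → V) → ℝ) : ∑ f, F f = F ![] := by
  rw [Fintype.sum_unique, Subsingleton.elim default ![]]

theorem sum_rotate_three (F : V → V → V → ℝ) :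
    ∑ a, ∑ b, ∑ j, F a b j = ∑ j, ∑ a, ∑ b, F a b j := by
  simpa only [Fintype.sum_prod_type] using Fintype.sum_equiv
    (⟨fun p => (p.2.2, p.1, p.2.1), fun p => (p.2.1, p.2.2, p.1), fun _ => rfl, fun _ => rfl⟩ :
      V × V × V ≃ V × V × V)
    (fun p => F p.1 p.2.1 p.2.2) (fun p => F p.2.1 p.2.2 p.1) fun _ => rfl

/-- The end node moves outermost and the middle node next, so that the two nodes beside the ends
form the inner sums. -/
theorem sum_rotate_four (F : V → V → V → V → ℝ) :
    ∑ a, ∑ b, ∑ c, ∑ j, F a b c j = ∑ j, ∑ b, ∑ a, ∑ c, F a b c j := by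
  simpa only [Fintype.sum_prod_type] using Fintype.sum_equiv
    (⟨fun p => (p.2.2.2, p.2.1, p.1, p.2.2.1), fun p => (p.2.2.1, p.2.1, p.2.2.2, p.1),
      fun _ => rfl, fun _ => rfl⟩ : V × V × V × V ≃ V × V × V × V)
    (fun p => F p.1 p.2.1 p.2.2.1 p.2.2.2) (fun p => F p.2.2.1 p.2.1 p.2.2.2 p.1) fun _ => rfl

theorem sum_rotate_five (F : V → V → V → V → V → ℝ) :
    ∑ a, ∑ b, ∑ c, ∑ d, ∑ j, F a b c d j = ∑ j, ∑ b, ∑ c, ∑ a, ∑ d, F a b c d j := by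
  simpa only [Fintype.sum_prod_type] using Fintype.sum_equiv
    (⟨fun p => (p.2.2.2.2, p.2.1, p.2.2.1, p.1, p.2.2.2.1),
      fun p => (p.2.2.2.1, p.2.1, p.2.2.1, p.2.2.2.2, p.1),
      fun _ => rfl, fun _ => rfl⟩ : V × V × V × V × V ≃ V × V × V × V × V)
    (fun p => F p.1 p.2.1 p.2.2.1 p.2.2.2.1 p.2.2.2.2)
    (fun p => F p.2.2.2.1 p.2.1 p.2.2.1 p.2.2.2.2 p.1) fun _ => rfl

open Classical in
theorem two_mul_nodeCycleCount_eq_sum (G : SimpleGraph V) (i : V) (m : ℕ) :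
    (2 * nodeCycleCount G (m + 3) i : ℝ) =
      ∑ f : Fin (m + 3) → V, if IsRootedCycle G i f then (1 : ℝ) else 0 := by
  rw [Finset.sum_boole, ← Fintype.card_subtype, card_isRootedCycle]
  push_cast
  rfl

end Sums

/-! ### Cycle counts as sums over neighbours and paths -/

section Counts

variable [DecidableEq V]

theorem ite_ne_eq_offDiag (x y : V) : (if x ≠ y then (1 : ℝ) else 0) = offDiag V x y := by
  by_cases h : x = y <;> simp [offDiag, h]

variable [Fintype V]

theorem sum_ite_eq_mul (i : V) (F : V → ℝ) :
    ∑ x, (if x = i then (1 : ℝ) else 0) * F x = F i := by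
  simp

variable (G : SimpleGraph V) [DecidableRel G.Adj] (i : V)

open Classical in
theorem two_mul_nodeCycleCount_three :
    (2 * nodeCycleCount G 3 i : ℝ) = ∑ j, G.adjMatrix ℝ i j *
      ∑ a, (G.adjMatrix ℝ i a * G.adjMatrix ℝ a j) := by
  rw [two_mul_nodeCycleCount_eq_sum G i 0]
  simp only [sum_fin_succ_fun, sum_fin_zero_fun]
  trans ∑ x, (if x = i then (1 : ℝ) else 0) * ∑ a, ∑ j, G.adjMatrix ℝ x j *
    (G.adjMatrix ℝ x a * G.adjMatrix ℝ a j)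
  · simp only [Finset.mul_sum]
    refine Finset.sum_congr rfl fun x _ => Finset.sum_congr rfl fun a _ =>
      Finset.sum_congr rfl fun j _ => ?_
    rw [if_congr isRootedCycle_three_iff rfl rfl]
    simp only [ite_and_eq_mul, ite_adj_eq]
    ring
  · rw [sum_ite_eq_mul, Finset.sum_comm]
    simp only [Finset.mul_sum]

open Classical in
theorem two_mul_nodeCycleCount_four :
    (2 * nodeCycleCount G 4 i : ℝ) = ∑ j, G.adjMatrix ℝ i j *
      ∑ a, ∑ b, (G.adjMatrix ℝ i a * G.adjMatrix ℝ a b * G.adjMatrix ℝ b j *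
        offDiag V i b * offDiag V a j) := by
  rw [two_mul_nodeCycleCount_eq_sum G i 1]
  simp only [sum_fin_succ_fun, sum_fin_zero_fun]
  trans ∑ x, (if x = i then (1 : ℝ) else 0) * ∑ a, ∑ b, ∑ j, G.adjMatrix ℝ x j *
    (G.adjMatrix ℝ x a * G.adjMatrix ℝ a b * G.adjMatrix ℝ b j *
        offDiag V x b * offDiag V a j)
  · simp only [Finset.mul_sum]
    refine Finset.sum_congr rfl fun x _ => Finset.sum_congr rfl fun a _ =>
      Finset.sum_congr rfl fun b _ => Finset.sum_congr rfl fun j _ => ?_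
    rw [if_congr isRootedCycle_four_iff rfl rfl]
    simp only [ite_and_eq_mul, ite_adj_eq, ite_ne_eq_offDiag]
    ring
  · rw [sum_ite_eq_mul, sum_rotate_three]
    simp only [Finset.mul_sum]

open Classical in
theorem two_mul_nodeCycleCount_five :
    (2 * nodeCycleCount G 5 i : ℝ) = ∑ j, G.adjMatrix ℝ i j *
      ∑ b, ∑ a, ∑ c, (G.adjMatrix ℝ i a * G.adjMatrix ℝ a b * G.adjMatrix ℝ b c *
        G.adjMatrix ℝ c j *
        offDiag V i b * offDiag V b j * offDiag V a j * offDiag V i c *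
        offDiag V a c) := by
  rw [two_mul_nodeCycleCount_eq_sum G i 2]
  simp only [sum_fin_succ_fun, sum_fin_zero_fun]
  trans ∑ x, (if x = i then (1 : ℝ) else 0) * ∑ a, ∑ b, ∑ c, ∑ j, G.adjMatrix ℝ x j *
    (G.adjMatrix ℝ x a * G.adjMatrix ℝ a b * G.adjMatrix ℝ b c *
        G.adjMatrix ℝ c j *
        offDiag V x b * offDiag V b j * offDiag V a j * offDiag V x c *
        offDiag V a c)
  · simp only [Finset.mul_sum]
    refine Finset.sum_congr rfl fun x _ => Finset.sum_congr rfl fun a _ =>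
      Finset.sum_congr rfl fun b _ => Finset.sum_congr rfl fun c _ =>
      Finset.sum_congr rfl fun j _ => ?_
    rw [if_congr isRootedCycle_five_iff rfl rfl]
    simp only [ite_and_eq_mul, ite_adj_eq, ite_ne_eq_offDiag]
    ring
  · rw [sum_ite_eq_mul, sum_rotate_four]
    simp only [Finset.mul_sum]

open Classical in
theorem two_mul_nodeCycleCount_six :
    (2 * nodeCycleCount G 6 i : ℝ) = ∑ j, G.adjMatrix ℝ i j *
      ∑ b, ∑ c, ∑ a, ∑ d, (G.adjMatrix ℝ i a * G.adjMatrix ℝ a b * G.adjMatrix ℝ b c *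
        G.adjMatrix ℝ c d * G.adjMatrix ℝ d j *
        offDiag V i b * offDiag V b j * offDiag V i c * offDiag V c j *
        offDiag V a c * offDiag V a j * offDiag V i d * offDiag V b d *
        offDiag V a d) := by
  rw [two_mul_nodeCycleCount_eq_sum G i 3]
  simp only [sum_fin_succ_fun, sum_fin_zero_fun]
  trans ∑ x, (if x = i then (1 : ℝ) else 0) * ∑ a, ∑ b, ∑ c, ∑ d, ∑ j, G.adjMatrix ℝ x j *
    (G.adjMatrix ℝ x a * G.adjMatrix ℝ a b * G.adjMatrix ℝ b c *
        G.adjMatrix ℝ c d * G.adjMatrix ℝ d j *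
        offDiag V x b * offDiag V b j * offDiag V x c * offDiag V c j *
        offDiag V a c * offDiag V a j * offDiag V x d * offDiag V b d *
        offDiag V a d)
  · simp only [Finset.mul_sum]
    refine Finset.sum_congr rfl fun x _ => Finset.sum_congr rfl fun a _ =>
      Finset.sum_congr rfl fun b _ => Finset.sum_congr rfl fun c _ =>
      Finset.sum_congr rfl fun d _ => Finset.sum_congr rfl fun j _ => ?_
    rw [if_congr isRootedCycle_six_iff rfl rfl]
    simp only [ite_and_eq_mul, ite_adj_eq, ite_ne_eq_offDiag]
    ring
  · rw [sum_ite_eq_mul, sum_rotate_five]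
    simp only [Finset.mul_sum]

end Counts

/-! ### Sums over distinct nodes -/

section Distinct

variable {V : Type*} [DecidableEq V]

theorem offDiag_self (x : V) : offDiag V x x = 0 := by simp [offDiag]

theorem offDiag_of_ne {x y : V} (h : x ≠ y) : offDiag V x y = 1 := by simp [offDiag, h]

theorem offDiag_comm (x y : V) : offDiag V x y = offDiag V y x := by
  simp only [offDiag, Matrix.of_apply, eq_comm]

theorem offDiag_eq_one_sub (x y : V) : offDiag V x y = 1 - if x = y then 1 else 0 := by
  by_cases h : x = y <;> simp [offDiag, h]

variable [Fintype V]

theorem sum_mul_offDiag (f : V → ℝ) (p : V) :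
    ∑ x, f x * offDiag V x p = ∑ x, f x - f p := by
  simp [offDiag_eq_one_sub, mul_sub, Finset.sum_sub_distrib]

/-- For `p ≠ q` the two excluded terms are distinct, so nothing is subtracted twice. -/
theorem sum_mul_offDiag_mul_offDiag (f : V → ℝ) {p q : V} (h : p ≠ q) :
    ∑ x, f x * offDiag V x p * offDiag V x q = ∑ x, f x - f p - f q := by
  rw [sum_mul_offDiag (fun x => f x * offDiag V x p), sum_mul_offDiag,
    offDiag_of_ne h.symm, mul_one]

theorem sum_sum_mul_offDiag (f g : V → ℝ) :
    ∑ x, ∑ y, f x * g y * offDiag V x y = (∑ x, f x) * (∑ y, g y) - ∑ x, f x * g x := by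
  rw [Finset.sum_mul, ← Finset.sum_sub_distrib]
  refine Finset.sum_congr rfl fun x _ => ?_
  have := sum_mul_offDiag (fun y => f x * g y) x
  rw [← Finset.mul_sum] at this
  rw [← this]
  exact Finset.sum_congr rfl fun y _ => by rw [offDiag_comm]

end Distinct

/-! ### Entries of powers of an adjacency matrix -/

section Powers

variable {V : Type*} {A : Matrix V V ℝ}

theorem adj_comm (hA : A.IsAdjMatrix) (x y : V) : A x y = A y x := hA.symm.apply y x

theorem adj_mul_self (hA : A.IsAdjMatrix) (x y : V) : A x y * A x y = A x y := by
  rcases hA.zero_or_one x y with h | h <;> simp [h]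

theorem ne_of_adj (hA : A.IsAdjMatrix) {x y : V} (h : A x y = 1) : x ≠ y := by
  rintro rfl
  rw [hA.apply_diag] at h
  exact zero_ne_one h

variable [DecidableEq V]

theorem adj_mul_offDiag (hA : A.IsAdjMatrix) (x y : V) : A x y * offDiag V x y = A x y := by
  by_cases h : x = y
  · subst h; rw [hA.apply_diag, zero_mul]
  · rw [offDiag_of_ne h, mul_one]

variable [Fintype V]

theorem sum_pow_mul_pow (A : Matrix V V ℝ) (k l : ℕ) (x y : V) :
    ∑ z, (A ^ k) x z * (A ^ l) z y = (A ^ (k + l)) x y := by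
  rw [pow_add, Matrix.mul_apply]

theorem sum_mul_pow (A : Matrix V V ℝ) (l : ℕ) (x y : V) :
    ∑ z, A x z * (A ^ l) z y = (A ^ (l + 1)) x y := by
  rw [pow_succ', Matrix.mul_apply]

theorem sum_pow_mul (A : Matrix V V ℝ) (l : ℕ) (x y : V) :
    ∑ z, (A ^ l) x z * A z y = (A ^ (l + 1)) x y := by
  rw [pow_succ, Matrix.mul_apply]

theorem sum_mul_self (A : Matrix V V ℝ) (x y : V) :
    ∑ z, A x z * A z y = (A ^ 2) x y := by
  rw [sq, Matrix.mul_apply]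

theorem pow_comm (hA : A.IsAdjMatrix) (k : ℕ) (x y : V) : (A ^ k) x y = (A ^ k) y x :=
  (hA.symm.pow k).apply y x

theorem sum_row (hA : A.IsAdjMatrix) (x : V) : ∑ y, A x y = (A ^ 2) x x := by
  rw [← sum_mul_self]
  exact Finset.sum_congr rfl fun y _ => by rw [adj_comm hA y x, adj_mul_self hA]

theorem sum_col (hA : A.IsAdjMatrix) (x : V) : ∑ y, A y x = (A ^ 2) x x := by
  rw [← sum_row hA]
  exact Finset.sum_congr rfl fun y _ => adj_comm hA y x

end Powers

/-! ### Paths between adjacent nodes -/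

section Paths

variable {V : Type*} [Fintype V] [DecidableEq V] {A : Matrix V V ℝ} {i j : V}

theorem sum_path_three (hA : A.IsAdjMatrix) (h : A i j = 1) :
    ∑ a, ∑ b, (A i a * A a b * A b j * offDiag V i b * offDiag V a j) =
      (A ^ 3) i j - (A ^ 2) i i - (A ^ 2) j j + 1 := by
  have hr (a : V) : ∑ b, (A i a * A a b * A b j * offDiag V i b * offDiag V a j) =
      (A i a * (A ^ 2) a j - A i a * A a i) * offDiag V a j := by
    rw [← sum_mul_self, Finset.mul_sum]
    simp only [offDiag_comm i]
    have := sum_mul_offDiag (fun b => A i a * (A a b * A b j)) i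
    rw [h, mul_one] at this
    rw [← this, Finset.sum_mul]
    exact Finset.sum_congr rfl fun b _ => by ring
  simp only [hr]
  rw [sum_mul_offDiag, Finset.sum_sub_distrib, sum_mul_pow, sum_mul_self, adj_comm hA j i, h]
  ring

/-- For a node `b`, the number of pairs of distinct nodes `a`, `c` with a path `i, a, b, c, j`. -/
def middleCount (A : Matrix V V ℝ) (i j b : V) : ℝ :=
  ((A ^ 2) i b - A b j) * ((A ^ 2) b j - A i b) - ∑ a, A i a * A a j * A a b

/-- With `b` fixed, `a` must avoid `j` and `c` must avoid `i`; as `A i j = 1`, these exclusions cost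
`A b j` and `A i b`. The condition `a ≠ c` subtracts the common neighbours of `i`, `j`, `b`. -/
theorem sum_path_four_middle (hA : A.IsAdjMatrix) (h : A i j = 1) (b : V) :
    ∑ a, ∑ c, (A i a * A a b * A b c * A c j *
        offDiag V i b * offDiag V b j * offDiag V a j * offDiag V i c * offDiag V a c) =
      middleCount A i j b * offDiag V b i * offDiag V b j := by
  have h1 := sum_mul_offDiag (fun a => A i a * A a b) j
  have h2 := sum_mul_offDiag (fun c => A b c * A c j) i
  rw [sum_mul_self, h, one_mul, adj_comm hA j b] at h1
  rw [sum_mul_self, h, mul_one, adj_comm hA b i] at h2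
  have h3 := sum_sum_mul_offDiag (fun a => A i a * A a b * offDiag V a j)
    (fun c => A b c * A c j * offDiag V c i)
  rw [h1, h2] at h3
  have h4 : ∑ a, A i a * A a b * offDiag V a j * (A b a * A a j * offDiag V a i) =
      ∑ a, A i a * A a j * A a b := by
    refine Finset.sum_congr rfl fun a _ => ?_
    have e1 := adj_mul_offDiag hA a j
    have e2 := adj_mul_offDiag hA i a
    have e3 := adj_mul_self hA a b
    rw [adj_comm hA b a, offDiag_comm a i]
    linear_combination (A i a * A a b * A a b * offDiag V i a) * e1 +
      (A a b * A a b * A a j) * e2 + A i a * A a j * e3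
  rw [h4] at h3
  rw [middleCount, ← h3, Finset.sum_mul, Finset.sum_mul]
  refine Finset.sum_congr rfl fun a _ => ?_
  rw [Finset.sum_mul, Finset.sum_mul]
  refine Finset.sum_congr rfl fun c _ => ?_
  rw [offDiag_comm i b, offDiag_comm i c]
  ring

theorem sum_common (hA : A.IsAdjMatrix) (i j : V) : ∑ a, A i a * A a j * A a i = (A ^ 2) i j := by
  rw [← sum_mul_self]
  refine Finset.sum_congr rfl fun a _ => ?_
  rw [adj_comm hA a i]
  linear_combination A a j * adj_mul_self hA i a

theorem sum_common' (hA : A.IsAdjMatrix) (i j : V) : ∑ a, A i a * A a j * A a j = (A ^ 2) i j := by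
  rw [← sum_mul_self]
  exact Finset.sum_congr rfl fun a _ => by rw [mul_assoc, adj_mul_self hA]

theorem sum_middleCount (hA : A.IsAdjMatrix) (i j : V) :
    ∑ b, middleCount A i j b = (A ^ 4) i j - (A ^ 3) i i - (A ^ 3) j j + (A ^ 2) i j -
      ∑ a, A i a * A a j * (A ^ 2) a a := by
  have e1 := sum_pow_mul_pow A 2 2 i j
  have e2 := sum_pow_mul A 2 i i
  have e3 := sum_mul_pow A 2 j j
  have e4 := sum_mul_self A i j
  have e5 : ∑ b, ∑ a, A i a * A a j * A a b = ∑ a, A i a * A a j * (A ^ 2) a a := by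
    rw [Finset.sum_comm]
    exact Finset.sum_congr rfl fun a _ => by rw [← Finset.mul_sum, sum_row hA]
  -- Every term becomes a sum over `b`, so the identity can be checked summand by summand.
  rw [← e1, ← e2, ← e3, ← e4, ← e5, ← Finset.sum_sub_distrib, ← Finset.sum_sub_distrib,
    ← Finset.sum_add_distrib, ← Finset.sum_sub_distrib]
  refine Finset.sum_congr rfl fun b _ => ?_
  rw [middleCount, adj_comm hA b i, adj_comm hA j b]
  ring

theorem middleCount_left (hA : A.IsAdjMatrix) (h : A i j = 1) :
    middleCount A i j i = ((A ^ 2) i i - 2) * (A ^ 2) i j := by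
  rw [middleCount, sum_common hA, h, hA.apply_diag]
  ring

theorem middleCount_right (hA : A.IsAdjMatrix) (h : A i j = 1) :
    middleCount A i j j = ((A ^ 2) j j - 2) * (A ^ 2) i j := by
  rw [middleCount, sum_common' hA, h, hA.apply_diag]
  ring

/-- The number of paths of length four between adjacent nodes. -/
theorem sum_path_four (hA : A.IsAdjMatrix) (h : A i j = 1) :
    ∑ b, ∑ a, ∑ c, (A i a * A a b * A b c * A c j *
        offDiag V i b * offDiag V b j * offDiag V a j * offDiag V i c * offDiag V a c) =
      (A ^ 4) i j - (A ^ 3) i i - (A ^ 3) j j - ∑ a, A i a * A a j * (A ^ 2) a a +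
        (A ^ 2) i j * (5 - (A ^ 2) i i - (A ^ 2) j j) := by
  simp only [sum_path_four_middle hA h]
  rw [sum_mul_offDiag_mul_offDiag _ (ne_of_adj hA h), sum_middleCount hA, middleCount_left hA h,
    middleCount_right hA h]
  ring

/-- For adjacent nodes `b`, `c`, the number of pairs of distinct nodes `a`, `d` with a path
`i, a, b, c, d, j`. -/
def edgeCount (A : Matrix V V ℝ) (i j b c : V) : ℝ :=
  ((A ^ 2) i b - A i c - A b j) * ((A ^ 2) c j - A i c - A b j) -
    ∑ a, A i a * A a j * A a b * A a c

theorem sum_path_five_middle (hA : A.IsAdjMatrix) (h : A i j = 1) (b c : V) :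
    ∑ a, ∑ d, (A i a * A a b * A b c * A c d * A d j *
        offDiag V i b * offDiag V b j * offDiag V i c * offDiag V c j *
        offDiag V a c * offDiag V a j * offDiag V i d * offDiag V b d * offDiag V a d) =
      A b c * edgeCount A i j b c * offDiag V c i * offDiag V c j *
        (offDiag V b i * offDiag V b j) := by
  -- In the three discarded cases both sides vanish. What is left provides `A b c = 1` and the
  -- inequalities `c ≠ j`, `i ≠ b` needed to exclude two values each for `a` and for `d`.
  by_cases hbc : A b c = 0
  · simp [hbc]
  replace hbc := (hA.zero_or_one b c).resolve_left hbc
  by_cases hib : i = b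
  · simp [hib, offDiag_self]
  by_cases hcj : c = j
  · simp [hcj, offDiag_self]
  have h1 := sum_mul_offDiag_mul_offDiag (fun a => A i a * A a b) hcj
  have h2 := sum_mul_offDiag_mul_offDiag (fun d => A c d * A d j) hib
  rw [sum_mul_self, h, one_mul, adj_comm hA j b, adj_comm hA c b, hbc, mul_one] at h1
  rw [sum_mul_self, h, mul_one, adj_comm hA c i, adj_comm hA c b, hbc, one_mul] at h2
  have h3 := sum_sum_mul_offDiag (fun a => A i a * A a b * offDiag V a c * offDiag V a j)
    (fun d => A c d * A d j * offDiag V d i * offDiag V d b)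
  rw [h1, h2] at h3
  have h4 : ∑ a, A i a * A a b * offDiag V a c * offDiag V a j *
      (A c a * A a j * offDiag V a i * offDiag V a b) = ∑ a, A i a * A a j * A a b * A a c := by
    refine Finset.sum_congr rfl fun a _ => ?_
    have e1 := adj_mul_offDiag hA a j
    have e2 := adj_mul_offDiag hA i a
    have e3 := adj_mul_offDiag hA a b
    have e4 := adj_mul_offDiag hA a c
    rw [adj_comm hA c a, offDiag_comm a i]
    calc _ = (A i a * offDiag V i a) * (A a j * offDiag V a j) * (A a b * offDiag V a b) *
          (A a c * offDiag V a c) := by ring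
      _ = _ := by rw [e1, e2, e3, e4]
  rw [h4] at h3
  rw [edgeCount, ← h3, hbc, one_mul, Finset.sum_mul, Finset.sum_mul, Finset.sum_mul]
  refine Finset.sum_congr rfl fun a _ => ?_
  rw [Finset.sum_mul, Finset.sum_mul, Finset.sum_mul]
  refine Finset.sum_congr rfl fun d _ => ?_
  rw [offDiag_comm i b, offDiag_comm i c, offDiag_comm i d, offDiag_comm b d]
  ring

end Paths

/-! ### Paths of length five: summing over the middle edge and removing the ends -/

section PathsFive

variable {V : Type*} [Fintype V] [DecidableEq V] {A : Matrix V V ℝ} {i j : V}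

theorem sum_sum_distinct (F : V → V → ℝ) (hij : i ≠ j) :
    ∑ b, ∑ c, F b c * offDiag V c i * offDiag V c j * (offDiag V b i * offDiag V b j) =
      ∑ b, ∑ c, F b c - ∑ b, F b i - ∑ b, F b j - (∑ c, F i c - F i i - F i j) -
        (∑ c, F j c - F j i - F j j) := by
  simp only [← Finset.sum_mul, sum_mul_offDiag_mul_offDiag _ hij, ← mul_assoc,
    Finset.sum_sub_distrib]

/-- After expansion each monomial counts walks. In the diagonal term `a` is joined to `i`, `j`, `b`,
`c`, and summing over the edge `b`, `c` leaves the closed walks of length three at `a`. -/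
theorem sum_sum_edgeCount (hA : A.IsAdjMatrix) (i j : V) :
    ∑ b, ∑ c, A b c * edgeCount A i j b c =
      (A ^ 5) i j - (A ^ 4) i i - (A ^ 4) j j + 2 * (A ^ 3) i j -
        ∑ b, (A ^ 2) i b * (A ^ 2) b b * A b j - ∑ c, A i c * (A ^ 2) c c * (A ^ 2) c j +
        ∑ c, A i c * (A ^ 2) c c + ∑ b, (A ^ 2) b b * A b j -
        ∑ a, A i a * (A ^ 3) a a * A a j := by
  have e1 : ∑ b, ∑ c, (A ^ 2) i b * A b c * (A ^ 2) c j = (A ^ 5) i j := by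
    rw [← sum_pow_mul_pow A 2 3]
    exact Finset.sum_congr rfl fun b _ => by
      rw [← sum_mul_pow A 2 b j, Finset.mul_sum]; exact Finset.sum_congr rfl fun c _ => mul_assoc _ _ _
  have e2 : ∑ b, ∑ c, (A ^ 2) i b * (A b c * A c i) = (A ^ 4) i i := by
    rw [← sum_pow_mul_pow A 2 2]
    exact Finset.sum_congr rfl fun b _ => by rw [← sum_mul_self A b i, Finset.mul_sum]
  have e3 : ∑ b, ∑ c, (A ^ 2) i b * A b j * A b c = ∑ b, (A ^ 2) i b * (A ^ 2) b b * A b j :=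
    Finset.sum_congr rfl fun b _ => by rw [← Finset.mul_sum, sum_row hA]; ring
  have e4 : ∑ b, ∑ c, A i c * (A ^ 2) c j * A b c = ∑ c, A i c * (A ^ 2) c c * (A ^ 2) c j := by
    rw [Finset.sum_comm]
    exact Finset.sum_congr rfl fun c _ => by rw [← Finset.mul_sum, sum_col hA]; ring
  have e5 : ∑ b, ∑ c, A i c * A b c = ∑ c, A i c * (A ^ 2) c c := by
    rw [Finset.sum_comm]
    exact Finset.sum_congr rfl fun c _ => by rw [← Finset.mul_sum, sum_col hA]
  have e6 : ∑ b, ∑ c, A i c * A c b * A b j = (A ^ 3) i j := by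
    rw [← sum_pow_mul A 2]
    exact Finset.sum_congr rfl fun b _ => by rw [← sum_mul_self, Finset.sum_mul]
  have e7 : ∑ b, ∑ c, A j b * (A b c * (A ^ 2) c j) = (A ^ 4) j j := by
    rw [← sum_mul_pow]
    exact Finset.sum_congr rfl fun b _ => by rw [← sum_mul_pow, Finset.mul_sum]
  have e8 : ∑ b, ∑ c, A b j * A b c = ∑ b, (A ^ 2) b b * A b j :=
    Finset.sum_congr rfl fun b _ => by rw [← Finset.mul_sum, sum_row hA, mul_comm]
  have e9 : ∑ b, ∑ c, A b c * ∑ a, A i a * A a j * A a b * A a c =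
      ∑ a, A i a * (A ^ 3) a a * A a j := by
    calc _ = ∑ b, ∑ a, A i a * A a j * A a b * (A ^ 2) b a := by
          refine Finset.sum_congr rfl fun b _ => ?_
          simp only [Finset.mul_sum]
          rw [Finset.sum_comm]
          refine Finset.sum_congr rfl fun a _ => ?_
          rw [← sum_mul_self, Finset.mul_sum]
          exact Finset.sum_congr rfl fun c _ => by rw [adj_comm hA c a]; ring
      _ = _ := by
          rw [Finset.sum_comm]
          refine Finset.sum_congr rfl fun a _ => ?_
          rw [← sum_mul_pow, Finset.mul_sum, Finset.sum_mul]
          exact Finset.sum_congr rfl fun b _ => by ring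
  rw [← e1, ← e2, ← e3, ← e4, ← e5, ← e6, ← e7, ← e8, ← e9]
  -- Only the scalar `2` is distributed, so that the sum over `a` keeps the shape it has in
  -- `edgeCount`.
  simp only [Finset.mul_sum (s := Finset.univ) (a := (2 : ℝ)), ← Finset.sum_sub_distrib,
    ← Finset.sum_add_distrib]
  refine Finset.sum_congr rfl fun b _ => Finset.sum_congr rfl fun c _ => ?_
  rw [edgeCount, adj_comm hA j b, adj_comm hA c i, adj_comm hA c b]
  linear_combination A b c * adj_mul_self hA i c + A b c * adj_mul_self hA b j

theorem sum_sum_common_left (hA : A.IsAdjMatrix) (i j x : V) :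
    ∑ b, A x b * ∑ a, A i a * A a j * A a b = ∑ a, A i a * A a j * (A ^ 2) x a := by
  simp only [Finset.mul_sum]
  rw [Finset.sum_comm]
  refine Finset.sum_congr rfl fun a _ => ?_
  rw [← sum_mul_self, Finset.mul_sum]
  exact Finset.sum_congr rfl fun b _ => by rw [adj_comm hA a b]; ring

/-- Reversal of paths. It turns the corrections for `c = i` and `c = j` into those for `b = j` and
`b = i`. -/
theorem edgeCount_swap (hA : A.IsAdjMatrix) (i j b c : V) :
    edgeCount A i j b c = edgeCount A j i c b := by
  have : ∑ a, A i a * A a j * A a b * A a c = ∑ a, A j a * A a i * A a c * A a b :=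
    Finset.sum_congr rfl fun a _ => by rw [adj_comm hA i a, adj_comm hA j a]; ring
  rw [edgeCount, edgeCount, this, pow_comm hA 2 i b, pow_comm hA 2 c j, adj_comm hA j b,
    adj_comm hA c i]
  ring

/-- Summing over `c` with `b` at the start of the path. -/
theorem sum_edgeCount_start (hA : A.IsAdjMatrix) (h : A i j = 1) :
    ∑ c, A i c * edgeCount A i j i c =
      ((A ^ 2) i i - 2) * ((A ^ 3) i j - 2 * (A ^ 2) i i) -
        ∑ a, A i a * A a j * (A ^ 2) i a := by
  have e1 := sum_mul_pow A 2 i j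
  have e2 := sum_row hA i
  have e3 := sum_sum_common_left hA i j i
  have e4 : ∀ c, ∑ a, A i a * A a j * A a i * A a c = ∑ a, A i a * A a j * A a c := fun c =>
    Finset.sum_congr rfl fun a _ => by
      rw [adj_comm hA a i]; linear_combination (A a j * A a c) * adj_mul_self hA i a
  rw [← e1]
  -- Only the degree inside the second factor becomes a row sum; the first occurrence stays as a
  -- coefficient.
  nth_rewrite 2 [← e2]
  rw [← e3, Finset.mul_sum, ← Finset.sum_sub_distrib, Finset.mul_sum, ← Finset.sum_sub_distrib]
  refine Finset.sum_congr rfl fun c _ => ?_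
  rw [edgeCount, e4, h]
  linear_combination (3 - (A ^ 2) i i - (A ^ 2) c j + A i c) * adj_mul_self hA i c

/-- Summing over `c` with `b` at the end of the path. -/
theorem sum_edgeCount_end (hA : A.IsAdjMatrix) (i j : V) :
    ∑ c, A j c * edgeCount A i j j c =
      (A ^ 2) i j * ((A ^ 3) j j + 1 - (A ^ 2) i j) - 2 * ∑ a, A i a * A a j * (A ^ 2) a j := by
  have e1 := sum_mul_pow A 2 j j
  have e2 := sum_mul_self A i j
  have e3 := sum_sum_common_left hA i j j
  have e4 : ∀ c, ∑ a, A i a * A a j * A a j * A a c = ∑ a, A i a * A a j * A a c := fun c =>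
    Finset.sum_congr rfl fun a _ => by
      linear_combination (A i a * A a c) * adj_mul_self hA a j
  have e5 : ∑ c, A j c * edgeCount A i j j c = (A ^ 2) i j * ∑ c, A j c * (A ^ 2) c j +
      (1 - (A ^ 2) i j) * ∑ c, A i c * A c j - ∑ c, A i c * A c j * (A ^ 2) c j -
      ∑ b, A j b * ∑ a, A i a * A a j * A a b := by
    rw [Finset.mul_sum, Finset.mul_sum, ← Finset.sum_add_distrib, ← Finset.sum_sub_distrib,
      ← Finset.sum_sub_distrib]
    refine Finset.sum_congr rfl fun c _ => ?_
    rw [edgeCount, e4, hA.apply_diag, adj_comm hA c j]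
    linear_combination A j c * adj_mul_self hA i c
  have e6 : ∑ a, A i a * A a j * (A ^ 2) j a = ∑ a, A i a * A a j * (A ^ 2) a j :=
    Finset.sum_congr rfl fun a _ => by rw [pow_comm hA 2 j a]
  rw [e5, e1, e2, e3, e6]
  ring

theorem edgeCount_start_end (hA : A.IsAdjMatrix) (h : A i j = 1) :
    edgeCount A i j i j = ((A ^ 2) i i - 2) * ((A ^ 2) j j - 2) - (A ^ 2) i j := by
  have e : ∑ a, A i a * A a j * A a i * A a j = (A ^ 2) i j := by
    rw [← sum_common hA]
    exact Finset.sum_congr rfl fun a _ => by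
      linear_combination (A i a * A a i) * adj_mul_self hA a j
  rw [edgeCount, e, h]
  ring

theorem edgeCount_end_start (hA : A.IsAdjMatrix) (i j : V) :
    edgeCount A i j j i = (A ^ 2) i j * (A ^ 2) i j - (A ^ 2) i j := by
  have e : ∑ a, A i a * A a j * A a j * A a i = (A ^ 2) i j := by
    rw [← sum_common hA]
    exact Finset.sum_congr rfl fun a _ => by
      linear_combination (A i a * A a i) * adj_mul_self hA a j
  rw [edgeCount, e, hA.apply_diag, hA.apply_diag]
  ring

/-- The number of paths of length five between adjacent nodes. -/
theorem sum_path_five (hA : A.IsAdjMatrix) (h : A i j = 1) :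
    ∑ b, ∑ c, ∑ a, ∑ d, (A i a * A a b * A b c * A c d * A d j *
        offDiag V i b * offDiag V b j * offDiag V i c * offDiag V c j *
        offDiag V a c * offDiag V a j * offDiag V i d * offDiag V b d * offDiag V a d) =
      (A ^ 5) i j - (A ^ 4) i i - (A ^ 4) j j + 2 * (A ^ 3) i j -
        ∑ b, (A ^ 2) i b * (A ^ 2) b b * A b j - ∑ c, A i c * (A ^ 2) c c * (A ^ 2) c j +
        ∑ c, A i c * (A ^ 2) c c + ∑ b, (A ^ 2) b b * A b j -
        ∑ a, A i a * (A ^ 3) a a * A a j -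
        (A ^ 2) i j * ((A ^ 3) i i + (A ^ 3) j j + 2 - 2 * (A ^ 2) i j) +
        3 * ∑ a, A i a * A a j * (A ^ 2) i a + 3 * ∑ a, A i a * A a j * (A ^ 2) a j -
        ((A ^ 2) i i - 2) * ((A ^ 3) i j - 2 * (A ^ 2) i i) -
        ((A ^ 2) j j - 2) * ((A ^ 3) i j - 2 * (A ^ 2) j j) +
        ((A ^ 2) i i - 2) * ((A ^ 2) j j - 2) + (A ^ 2) i j * (A ^ 2) i j - 2 * (A ^ 2) i j := by
  have hji : A j i = 1 := by rw [adj_comm hA, h]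
  have e1 : ∑ b, A b i * edgeCount A i j b i =
      (A ^ 2) i j * ((A ^ 3) i i + 1 - (A ^ 2) i j) - 2 * ∑ a, A i a * A a j * (A ^ 2) i a := by
    have := sum_edgeCount_end hA j i
    rw [pow_comm hA 2 j i] at this
    simp only [edgeCount_swap hA j i i] at this
    rw [show ∑ a, A j a * A a i * (A ^ 2) a i = ∑ a, A i a * A a j * (A ^ 2) i a from
      Finset.sum_congr rfl fun a _ => by
        rw [adj_comm hA j a, adj_comm hA a i, pow_comm hA 2 a i]; ring] at this
    rw [← this]
    exact Finset.sum_congr rfl fun b _ => by rw [adj_comm hA b i]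
  have e2 : ∑ b, A b j * edgeCount A i j b j =
      ((A ^ 2) j j - 2) * ((A ^ 3) i j - 2 * (A ^ 2) j j) -
        ∑ a, A i a * A a j * (A ^ 2) a j := by
    have := sum_edgeCount_start hA hji
    rw [pow_comm hA 3 j i] at this
    simp only [edgeCount_swap hA j i j] at this
    rw [show ∑ a, A j a * A a i * (A ^ 2) j a = ∑ a, A i a * A a j * (A ^ 2) a j from
      Finset.sum_congr rfl fun a _ => by
        rw [adj_comm hA j a, adj_comm hA a i, pow_comm hA 2 j a]; ring] at this
    rw [← this]
    exact Finset.sum_congr rfl fun b _ => by rw [adj_comm hA b j]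
  simp only [sum_path_five_middle hA h]
  rw [sum_sum_distinct (fun b c => A b c * edgeCount A i j b c) (ne_of_adj hA h),
    sum_sum_edgeCount hA, e1, e2, sum_edgeCount_start hA h, sum_edgeCount_end hA,
    edgeCount_start_end hA h, edgeCount_end_start hA, hA.apply_diag, hA.apply_diag, h, hji]
  ring

end PathsFive

/-! ### The entries of the path matrices -/

section Entries

variable {V : Type*} [DecidableEq V]

theorem hadamard_one_eq_diagonal (M : Matrix V V ℝ) : M ⊙ 1 = Matrix.diagonal fun x => M x x := by
  ext x y
  by_cases h : x = y
  · subst h; simp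
  · simp [h]

variable [Fintype V] {A : Matrix V V ℝ} {i j : V}

theorem pathX2_apply (x y : V) : pathX2 A x y = (A ^ 2) x y * offDiag V x y := rfl

theorem pathX3_apply (hA : A.IsAdjMatrix) (h : A i j = 1) :
    pathX3 A i j = (A ^ 3) i j - (A ^ 2) i i - (A ^ 2) j j + 1 := by
  simp only [pathX3, hadamard_one_eq_diagonal, Matrix.add_apply, Matrix.sub_apply,
    Matrix.hadamard_apply, Matrix.mul_diagonal, Matrix.diagonal_mul,
    offDiag_of_ne (ne_of_adj hA h), h]
  ring

theorem pathX4_apply (hA : A.IsAdjMatrix) (h : A i j = 1) :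
    pathX4 A i j = (A ^ 4) i j - (A ^ 3) i i - (A ^ 3) j j - ∑ a, A i a * A a j * (A ^ 2) a a +
        (A ^ 2) i j * (5 - (A ^ 2) i i - (A ^ 2) j j) := by
  have e : (A * (Matrix.diagonal (fun x => (A ^ 2) x x) - (2 : ℝ) • 1) * A) i j =
      ∑ a, A i a * A a j * (A ^ 2) a a - 2 * (A ^ 2) i j := by
    rw [← sum_mul_self, Finset.mul_sum, ← Finset.sum_sub_distrib, ← Matrix.diagonal_one,
      ← Matrix.diagonal_smul, Matrix.diagonal_sub, Matrix.mul_apply]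
    refine Finset.sum_congr rfl fun a _ => ?_
    rw [Matrix.mul_diagonal]
    simp only [Pi.smul_apply, smul_eq_mul]
    ring
  simp only [pathX4, hadamard_one_eq_diagonal, Matrix.add_apply, Matrix.sub_apply,
    Matrix.hadamard_apply, Matrix.mul_diagonal, Matrix.diagonal_mul, e, pathX2_apply,
    Matrix.smul_apply, smul_eq_mul, offDiag_of_ne (ne_of_adj hA h), h]
  ring

/-- `pathX3_apply` covers adjacent pairs only, which suffices because the factor `A x y` kills all
others. -/
theorem rowSum_hadamard_pathX3 (hA : A.IsAdjMatrix) (x : V) :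
    ((A ⊙ pathX3 A) *ᵥ 1) x =
      (A ^ 4) x x - ∑ y, A x y * (A ^ 2) y y - (A ^ 2) x x * (A ^ 2) x x + (A ^ 2) x x := by
  have e : ∀ y, (A ⊙ pathX3 A) x y = A x y * (A ^ 3) y x - A x y * (A ^ 2) y y -
      (A ^ 2) x x * A x y + A x y := by
    intro y
    rw [Matrix.hadamard_apply]
    rcases hA.zero_or_one x y with h | h
    · simp [h]
    · rw [pathX3_apply hA h, h, pow_comm hA 3 y x]; ring
  simp only [Matrix.mulVec, dotProduct, e, Pi.one_apply, mul_one, Finset.sum_add_distrib,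
    Finset.sum_sub_distrib, ← Finset.mul_sum, sum_row hA, sum_mul_pow]

/-- Entries of `A ^ 2` are nonnegative, so multiplying one by its positivity indicator does not
change it. -/
theorem mul_sub_isPos (hA : A.IsAdjMatrix) (x y : V) :
    (A ^ 2) x y * ((A ^ 2) x y - isPos (A ^ 2) x y) =
      (A ^ 2) x y * (A ^ 2) x y - (A ^ 2) x y := by
  have h0 : 0 ≤ (A ^ 2) x y := by
    rw [← sum_mul_self]
    refine Finset.sum_nonneg fun z _ => mul_nonneg ?_ ?_
    · rcases hA.zero_or_one x z with h | h <;> simp [h]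
    · rcases hA.zero_or_one z y with h | h <;> simp [h]
  rw [isPos, Matrix.map_apply]
  split_ifs with h
  · ring
  · rw [le_antisymm (not_lt.1 h) h0]; ring

theorem pathX5_apply (hA : A.IsAdjMatrix) (h : A i j = 1) :
    pathX5 A i j = (A ^ 5) i j - (A ^ 4) i i - (A ^ 4) j j + 2 * (A ^ 3) i j -
        ∑ b, (A ^ 2) i b * (A ^ 2) b b * A b j - ∑ c, A i c * (A ^ 2) c c * (A ^ 2) c j +
        ∑ c, A i c * (A ^ 2) c c + ∑ b, (A ^ 2) b b * A b j -
        ∑ a, A i a * (A ^ 3) a a * A a j -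
        (A ^ 2) i j * ((A ^ 3) i i + (A ^ 3) j j + 2 - 2 * (A ^ 2) i j) +
        3 * ∑ a, A i a * A a j * (A ^ 2) i a + 3 * ∑ a, A i a * A a j * (A ^ 2) a j -
        ((A ^ 2) i i - 2) * ((A ^ 3) i j - 2 * (A ^ 2) i i) -
        ((A ^ 2) j j - 2) * ((A ^ 3) i j - 2 * (A ^ 2) j j) +
        ((A ^ 2) i i - 2) * ((A ^ 2) j j - 2) + (A ^ 2) i j * (A ^ 2) i j - 2 * (A ^ 2) i j := by
  have hdeg : Matrix.diagonal (fun x => (A ^ 2) x x) - (1 : Matrix V V ℝ) =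
      Matrix.diagonal fun x => (A ^ 2) x x - 1 := by
    rw [← Matrix.diagonal_one, Matrix.diagonal_sub]
  have e1 : (A * Matrix.diagonal (fun x => (A ^ 2) x x - 1) * pathX2 A) i j =
      ∑ c, A i c * (A ^ 2) c c * (A ^ 2) c j - (A ^ 3) i j -
        ((A ^ 2) j j - 1) * (A ^ 2) j j := by
    have := sum_mul_offDiag (fun c => A i c * ((A ^ 2) c c - 1) * (A ^ 2) c j) j
    rw [h, one_mul] at this
    rw [← sum_mul_pow, ← Finset.sum_sub_distrib]
    convert! this using 1
    · rw [Matrix.mul_apply]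
      refine Finset.sum_congr rfl fun c _ => ?_
      rw [Matrix.mul_diagonal, pathX2_apply]; ring
    · congr 1
      exact Finset.sum_congr rfl fun c _ => by ring
  have e2 : (pathX2 A * Matrix.diagonal (fun x => (A ^ 2) x x - 1) * A) i j =
      ∑ b, (A ^ 2) i b * (A ^ 2) b b * A b j - (A ^ 3) i j -
        ((A ^ 2) i i - 1) * (A ^ 2) i i := by
    have := sum_mul_offDiag (fun b => (A ^ 2) i b * ((A ^ 2) b b - 1) * A b j) i
    rw [h, mul_one] at this
    rw [← sum_pow_mul, ← Finset.sum_sub_distrib, mul_comm ((A ^ 2) i i - 1)]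
    convert! this using 1
    · rw [Matrix.mul_apply]
      refine Finset.sum_congr rfl fun b _ => ?_
      rw [Matrix.mul_diagonal, pathX2_apply, offDiag_comm i b]; ring
    · congr 1
      exact Finset.sum_congr rfl fun b _ => by ring
  have e3 : (A * Matrix.diagonal (fun x => (A ^ 3) x x) * A) i j =
      ∑ a, A i a * (A ^ 3) a a * A a j := by
    rw [Matrix.mul_apply]
    exact Finset.sum_congr rfl fun a _ => by rw [Matrix.mul_diagonal]
  have e4 : (A * (A ⊙ (A ^ 2))) i j = ∑ a, A i a * A a j * (A ^ 2) a j := by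
    rw [Matrix.mul_apply]
    exact Finset.sum_congr rfl fun a _ => by rw [Matrix.hadamard_apply]; ring
  have e5 : ((A ⊙ (A ^ 2)) * A) i j = ∑ a, A i a * A a j * (A ^ 2) i a := by
    rw [Matrix.mul_apply]
    exact Finset.sum_congr rfl fun a _ => by rw [Matrix.hadamard_apply]; ring
  have e6 : ∑ y, A j y * (A ^ 2) y y = ∑ b, (A ^ 2) b b * A b j :=
    Finset.sum_congr rfl fun b _ => by rw [adj_comm hA j b, mul_comm]
  have e7 := mul_sub_isPos hA i j
  simp only [pathX5, hadamard_one_eq_diagonal, hdeg, Matrix.add_apply, Matrix.sub_apply,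
    Matrix.hadamard_apply, Matrix.mul_diagonal, Matrix.diagonal_mul,
    Matrix.diagonal_mul_diagonal, e1, e2, e3, e4, e5, e6,
    pathX2_apply, pathX3_apply hA h, rowSum_hadamard_pathX3 hA,
    Matrix.smul_apply, smul_eq_mul, offDiag_of_ne (ne_of_adj hA h), h]
  -- The coefficient is that of the `isPos` summand of `pathX5`.
  linear_combination 3 * e7

end Entries

theorem hadamard_mulVec_one_apply {V : Type*} [Fintype V] (A M : Matrix V V ℝ) (i : V) :
    ((A ⊙ M) *ᵥ 1) i = ∑ j, A i j * M i j := by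
  simp [Matrix.mulVec, dotProduct]

/-- The row sums of the cycle matrices count the cycles through each node twice. -/
theorem cycleC_mulVec_one_apply {V : Type*} [Fintype V] [DecidableEq V] (l : ℕ) (hl : 3 ≤ l)
    (hl' : l ≤ 6) (G : SimpleGraph V) [DecidableRel G.Adj] (i : V) :
    (cycleC l (G.adjMatrix ℝ) *ᵥ 1) i = 2 * nodeCycleCount G l i := by
  have hA : (G.adjMatrix ℝ).IsAdjMatrix := G.isAdjMatrix_adjMatrix ℝ
  rw [cycleC, hadamard_mulVec_one_apply]
  interval_cases l
  · rw [two_mul_nodeCycleCount_three]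
    refine Finset.sum_congr rfl fun j _ => ?_
    -- Nodes `j` not adjacent to `i` contribute zero on both sides, so only adjacent pairs matter.
    rcases hA.zero_or_one i j with h | h
    · simp only [h, zero_mul]
    · rw [sum_mul_self]
      simp only [pathX, pathX2_apply, offDiag_of_ne (ne_of_adj hA h), mul_one]
  · rw [two_mul_nodeCycleCount_four]
    refine Finset.sum_congr rfl fun j _ => ?_
    rcases hA.zero_or_one i j with h | h
    · simp only [h, zero_mul]
    · rw [sum_path_three hA h]
      simp only [pathX, pathX3_apply hA h]
  · rw [two_mul_nodeCycleCount_five]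
    refine Finset.sum_congr rfl fun j _ => ?_
    rcases hA.zero_or_one i j with h | h
    · simp only [h, zero_mul]
    · rw [sum_path_four hA h]
      simp only [pathX, pathX4_apply hA h]
  · rw [two_mul_nodeCycleCount_six]
    refine Finset.sum_congr rfl fun j _ => ?_
    rcases hA.zero_or_one i j with h | h
    · simp only [h, zero_mul]
    · rw [sum_path_five hA h]
      simp only [pathX, pathX5_apply hA h]

end CycleCounting

theorem mainTheorem9 (l : ℕ) (hl : 3 ≤ l) (hl' : l ≤ 6) :
    (∃ w : CycleCounting.Word .node .one,
      ∀ (n : ℕ) (G : SimpleGraph (Fin n)) [DecidableRel G.Adj] (i : Fin n),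
        w.eval (G.adjMatrix ℝ) i 0 =
          ((1 / 2 : ℝ) • (CycleCounting.cycleC l (G.adjMatrix ℝ) *ᵥ 1)) i) ∧
    ∀ (n : ℕ) (G : SimpleGraph (Fin n)) [DecidableRel G.Adj] (i : Fin n),
      ((1 / 2 : ℝ) • (CycleCounting.cycleC l (G.adjMatrix ℝ) *ᵥ 1)) i =
        (CycleCounting.nodeCycleCount G l i : ℝ) := by
  constructor
  · obtain ⟨w, hw⟩ := CycleCounting.Expressible.half_rowSum_cycleC l hl hl'
    exact ⟨w, fun n G _ i => by rw [hw]; rfl⟩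
  · intro n G _ i
    rw [Pi.smul_apply, CycleCounting.cycleC_mulVec_one_apply l hl hl', smul_eq_mul]
    ring
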